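/- **Theorem.** Let $D$ be a probability distribution of pairs $(x,y)$, $x\in\mathcal X$, $y\in\{0,1\}$. Let $\eta(x)=D(y=1\mid x)$ and let $\mathrm{Err}^*=\inf_h D(h(x)\neq y)$ be the Bayes error, where the infimum is over all measurable $h:\mathcal X\to\{0,1\}$. For every $c>0$ there is a constant $C'>0$, depending only on $c$, such that the following holds. Let $n\ge 1$ and $\sigma\ge 0$, let $x_1,\dots,x_n$ be i.i.d. with the $\mathcal X$-marginal distribution of $D$, and write $\eta_i=\eta(x_i)$. Let $\epsilon_1,\dots,\epsilon_n$ be independent real random variables with $\mathbb E[\epsilon_i]=0$ and $\mathrm{Var}(\epsilon_i)\le\sigma^2$; they may depend on the $x_i$. Conditionally on $(x_{1:n},\epsilon_{1:n})$, let the hard labels $y_1,\dots,y_n\in\{0,1\}$ be independent with $y_i=1$ having probability $\eta_i$. Let $f$ be continuous on $[0,1]$ and differentiable on $(0,1)$ with $f'\ge c$ there, and let the corrupted soft labels be $$\tilde\eta_i=f(\eta_i)+\epsilon_i .$$ Reorder the pairs $(\tilde\eta_i,y_i)$ into $(\tilde\eta_{(i)},y_{(i)})$ with $\tilde\eta_{(1)}\le\dots\le\tilde\eta_{(n)}$,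 where ties are broken by any measurable rule that uses only $\tilde\eta_{1:n}$ and not the hard labels. Let $\hat\eta^{\mathrm{iso}}_{(1)},\dots,\hat\eta^{\mathrm{iso}}_{(n)}$ be the minimizer of $\frac1n\sum_{i=1}^n (y_{(i)}-u_i)^2$ over all $0\le u_1\le\dots\le u_n\le 1$, and put $$\widehat{\mathrm{Err}}=\frac1n\sum_{i=1}^n\min\{\hat\eta^{\mathrm{iso}}_{(i)},\,1-\hat\eta^{\mathrm{iso}}_{(i)}\}.$$ Then for every $\delta\in(0,1)$, with probability at least $1-\delta$, $$\bigl|\widehat{\mathrm{Err}}-\mathrm{Err}^*\bigr|\le C'\left(\sigma+\frac1{n^{1/3}}+\sqrt{\frac{\log(1/\delta)}{n}}\right).$$ -/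

import Mathlib

open MeasureTheory ProbabilityTheory

noncomputable section

/-- The clean soft label `η(x) = D(y = 1 ∣ x)` of a distribution `D` on instance-label pairs: the mass
that the regular conditional distribution of the label given `x` puts on the label `1`.
Labels are Booleans, `true` being the label `1` and `false` the label `0`. -/
def softLabel {𝒳 : Type*} [MeasurableSpace 𝒳] (D : Measure (𝒳 × Bool)) [IsFiniteMeasure D]
    (x : 𝒳) : ℝ :=
  (D.condKernel x).real {true}

/-- The error rate of a classifier. -/
def errorRate {𝒳 : Type*} [MeasurableSpace 𝒳] (D : Measure (𝒳 × Bool)) (h : 𝒳 → Bool) : ℝ :=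
  D.real {p | p.2 ≠ h p.1}

/-- The Bayes error: the infimum of the error rate over all measurable classifiers. -/
def bayesError {𝒳 : Type*} [MeasurableSpace 𝒳] (D : Measure (𝒳 × Bool)) : ℝ :=
  ⨅ h : {h : 𝒳 → Bool // Measurable h}, errorRate D h.1

/-- The plug-in estimator `(1/n) ∑ min {q i, 1 - q i}` of the Bayes error. -/
def plugInError {n : ℕ} (q : Fin n → ℝ) : ℝ :=
  (1 / (n : ℝ)) * ∑ i, min (q i) (1 - q i)

/-- The non-decreasing sequences of length `n` with values in `[0, 1]`. -/
def monoSeq (n : ℕ) : Set (Fin n → ℝ) :=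
  {u | Monotone u ∧ ∀ i, 0 ≤ u i ∧ u i ≤ 1}

/-- The numerical value of a label. -/
def labelVal (b : Bool) : ℝ := if b then 1 else 0

/-- The mean squared error between a label sequence and a sequence of reals. -/
def sqError {n : ℕ} (y : Fin n → Bool) (u : Fin n → ℝ) : ℝ :=
  (1 / (n : ℝ)) * ∑ i, (labelVal (y i) - u i) ^ 2

theorem exists_isotonicFit {n : ℕ} (y : Fin n → Bool) :
    ∃ u ∈ monoSeq n, IsMinOn (sqError y) (monoSeq n) u := by
  have hc : IsClosed (monoSeq n) := by
    have h1 : IsClosed {u : Fin n → ℝ | Monotone u} := by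
      simp only [Monotone, Set.ofPred_forall]
      exact isClosed_iInter fun i => isClosed_iInter fun j => isClosed_iInter fun _ =>
        isClosed_le (continuous_apply i) (continuous_apply j)
    have h2 : IsClosed {u : Fin n → ℝ | ∀ i, 0 ≤ u i ∧ u i ≤ 1} := by
      simp only [Set.ofPred_forall]
      exact isClosed_iInter fun i =>
        (isClosed_le continuous_const (continuous_apply i)).inter
          (isClosed_le (continuous_apply i) continuous_const)
    exact h1.inter h2
  have hK : IsCompact (monoSeq n) := by
    refine (isCompact_Icc (a := (0 : Fin n → ℝ)) (b := 1)).of_isClosed_subset hc ?_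
    intro u hu
    exact ⟨fun i => (hu.2 i).1, fun i => (hu.2 i).2⟩
  refine hK.exists_isMinOn ⟨0, monotone_const, fun i => by simp⟩ ?_
  unfold sqError
  fun_prop

/-- Isotonic regression of an already ordered label sequence: the non-decreasing `[0, 1]`-valued
sequence with the smallest squared error. -/
def isotonicFit {n : ℕ} (y : Fin n → Bool) : Fin n → ℝ :=
  (exists_isotonicFit y).choose

/-- A measurable rule that reorders `n` real scores into a non-decreasing sequence. Ties are broken
in an arbitrary way, but on the basis of the scores alone (the labels are not looked at). -/
structure SortingRule (n : ℕ) where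
  perm : (Fin n → ℝ) → Equiv.Perm (Fin n)
  sorted : ∀ s, Monotone (s ∘ perm s)
  measurable : ∀ π, MeasurableSet {s | perm s = π}

/-- The isotonic-calibration estimator of the Bayes error from scores `s` and hard labels `y`:
reorder the pairs by score, fit the reordered labels by isotonic regression, plug in. -/
def isotonicEstimator {n : ℕ} (τ : SortingRule n) (s : Fin n → ℝ) (y : Fin n → Bool) : ℝ :=
  plugInError (isotonicFit (y ∘ τ.perm s))

/-- Each hard label is sampled from the true posterior of its instance: conditionally on all the
instances and all the noise variables, the labels are independent, the `i`-th one being `1` with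
probability `η(X i)`. -/
def LabelsFromPosterior {𝒳 Ω : Type*} [MeasurableSpace 𝒳] [MeasurableSpace Ω]
    (D : Measure (𝒳 × Bool)) [IsFiniteMeasure D] (P : Measure Ω) {n : ℕ}
    (X : Fin n → Ω → 𝒳) (Y : Fin n → Ω → Bool) (ε : Fin n → Ω → ℝ) : Prop :=
  ∀ y : Fin n → Bool,
    P[Set.indicator {ω | ∀ i, Y i ω = y i} (fun _ => (1 : ℝ)) |
        MeasurableSpace.comap (fun ω => ((fun i => X i ω), (fun i => ε i ω))) inferInstance]
      =ᵐ[P] fun ω => ∏ i, if y i then softLabel D (X i ω) else 1 - softLabel D (X i ω)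

end

/-!
The isotonic fit is never analysed as an estimator of the soft labels. The first-order optimality
conditions of the projection onto the non-decreasing `[0, 1]`-valued sequences
(`sum_residual_mul_le_zero`) show that its plug-in sum `∑ min (u j) (1 - u j)` is the smallest
empirical error, over `k`, of the rule that predicts `0` at the first `k` positions of the sorted
sequence and `1` at the others (`sum_min_isotonicFit_le`,
`exists_thresholdLoss_le_sum_min_isotonicFit`). The estimator is thus the minimum of `n + 1`
linear functionals of the labels, and only these have to be controlled.

Replacing the labels by the clean soft labels changes each functional by a signed sum of centred
labels. The signs depend on the instances and the noise alone, so conditionally on these the sum is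
sub-Gaussian (`measureReal_labelSum_ge_le`), and a union bound over `k` costs only a logarithm,
well below the `n ^ (-1 / 3)` allowed. For the clean soft labels the best threshold loss is at
least `∑ min (η i) (1 - η i)`, and exceeds it by at most `2 * ∑ min (|ε i| / c) 1`: since `f`
increases at rate at least `c`, noise `ε i` can only misplace an instance with
`|η i - 1 / 2| ≤ |ε i| / c` (`exists_thresholdLoss_le_of_corruption`).

The truncated noise has mean at most `σ / c`, and the Bayes error is the mean of
`min (η x) (1 - η x)` (`bayesError_eq_integral`), so Hoeffding's inequality bounds the deviation of
both averages.
-/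


/-! ### Isotonic regression as a threshold rule -/

/-- The loss on `p` of the rule that predicts the label `0` at the first `k` positions and the
label `1` at the others: `p j` is the cost of predicting `0` at `j`, and `1 - p j` that of
predicting `1`. -/
def thresholdLoss {n : ℕ} (p : Fin n → ℝ) (k : ℕ) : ℝ :=
  ∑ j : Fin n, if (j : ℕ) < k then p j else 1 - p j

/-- First-order optimality of the isotonic fit, against all directions of the tangent cone of
`monoSeq n` at the fit. -/
theorem sum_residual_mul_le_zero {n : ℕ} {y : Fin n → Bool} {u : Fin n → ℝ}
    (hu : u ∈ monoSeq n) (hmin : IsMinOn (sqError y) (monoSeq n) u) (d : Fin n → ℝ)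
    (hd : ∀ i j, i ≤ j → u i = u j → d i ≤ d j) (h0 : ∀ i, u i = 0 → 0 ≤ d i)
    (h1 : ∀ i, u i = 1 → d i ≤ 0) :
    ∑ i, (labelVal (y i) - u i) * d i ≤ 0 := by
  rcases Nat.eq_zero_or_pos n with rfl | hn
  · simp
  have hpos : ∀ x e : ℝ, 0 ≤ x → (x = 0 → 0 ≤ e) → ∀ᶠ t in nhdsWithin (0 : ℝ) (Set.Ioi 0), 0 ≤ x + t * e := by
    intro x e hx he
    rcases hx.eq_or_lt with hx | hx
    · filter_upwards [self_mem_nhdsWithin] with t ht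
      rw [← hx, zero_add]
      exact mul_nonneg (le_of_lt ht) (he hx.symm)
    · have hc : Filter.Tendsto (fun t : ℝ => x + t * e) (nhdsWithin 0 (Set.Ioi 0)) (nhds x) := by
        have : Continuous fun t : ℝ => x + t * e := by fun_prop
        simpa using (this.tendsto 0).mono_left nhdsWithin_le_nhds
      exact (hc.eventually (lt_mem_nhds hx)).mono fun t ht => ht.le
  have hfeas : ∀ᶠ t in nhdsWithin (0 : ℝ) (Set.Ioi 0), (fun i => u i + t * d i) ∈ monoSeq n := by
    have hm : ∀ᶠ t in nhdsWithin (0 : ℝ) (Set.Ioi 0), ∀ i j, i ≤ j → 0 ≤ (u j - u i) + t * (d j - d i) := by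
      refine Filter.eventually_all.2 fun i => Filter.eventually_all.2 fun j => ?_
      by_cases hij : i ≤ j
      · refine (hpos _ (d j - d i) (sub_nonneg.2 (hu.1 hij)) fun h => ?_).mono fun t ht _ => ht
        exact sub_nonneg.2 (hd i j hij (by linarith))
      · exact Filter.Eventually.of_forall fun t h => absurd h hij
    have hl : ∀ᶠ t in nhdsWithin (0 : ℝ) (Set.Ioi 0), ∀ i, 0 ≤ u i + t * d i :=
      Filter.eventually_all.2 fun i => hpos _ _ (hu.2 i).1 (h0 i)
    have hr : ∀ᶠ t in nhdsWithin (0 : ℝ) (Set.Ioi 0), ∀ i, 0 ≤ (1 - u i) + t * (-d i) :=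
      Filter.eventually_all.2 fun i => hpos _ _ (sub_nonneg.2 (hu.2 i).2) fun h =>
        neg_nonneg.2 (h1 i (by linarith))
    filter_upwards [hm, hl, hr] with t hm hl hr
    exact ⟨fun i j hij => by have := hm i j hij; simp only; linarith,
      fun i => ⟨hl i, by have := hr i; simp only; linarith⟩⟩
  have hlim : Filter.Tendsto (fun t : ℝ => t * (∑ i, d i ^ 2) / 2) (nhdsWithin 0 (Set.Ioi 0)) (nhds 0) := by
    have : Continuous fun t : ℝ => t * (∑ i, d i ^ 2) / 2 := by fun_prop
    simpa using (this.tendsto 0).mono_left nhdsWithin_le_nhds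
  refine ge_of_tendsto hlim ?_
  filter_upwards [hfeas, self_mem_nhdsWithin] with t ht (ht0 : 0 < t)
  have hle : ∑ i, (labelVal (y i) - u i) ^ 2 ≤ ∑ i, (labelVal (y i) - (u i + t * d i)) ^ 2 :=
    le_of_mul_le_mul_left (hmin ht) (by positivity)
  have hexp : ∑ i, (labelVal (y i) - (u i + t * d i)) ^ 2
      = ∑ i, (labelVal (y i) - u i) ^ 2 - 2 * t * ∑ i, (labelVal (y i) - u i) * d i
        + t ^ 2 * ∑ i, d i ^ 2 := by
    simp only [Finset.mul_sum, ← Finset.sum_sub_distrib, ← Finset.sum_add_distrib]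
    exact Finset.sum_congr rfl fun i _ => by ring
  have : t * (2 * ∑ i, (labelVal (y i) - u i) * d i) ≤ t * (t * ∑ i, d i ^ 2) := by nlinarith
  have := le_of_mul_le_mul_left this ht0
  linarith

theorem labelVal_mem_Icc (b : Bool) : labelVal b ∈ Set.Icc (0 : ℝ) 1 := by
  cases b <;> simp [labelVal]

/-- The plug-in sum of the isotonic fit is at most the empirical error of any threshold rule. -/
theorem sum_min_isotonicFit_le {n : ℕ} (y : Fin n → Bool) (k : ℕ) :
    ∑ i, min (isotonicFit y i) (1 - isotonicFit y i)
      ≤ thresholdLoss (fun i => labelVal (y i)) k := by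
  obtain ⟨hu, hmin⟩ := (exists_isotonicFit y).choose_spec
  change isotonicFit y ∈ _ at hu
  change IsMinOn _ _ (isotonicFit y) at hmin
  set u := isotonicFit y
  -- the direction that lowers the first `k` values and raises the others, made feasible on the
  -- faces `u = 0` and `u = 1`, where the residual has a sign
  have h := sum_residual_mul_le_zero hu hmin
    (fun j => if u j = 0 then 1 else if u j = 1 then -1 else if (j : ℕ) < k then -1 else 1)
    (by
      intro i j hij he
      have hij' : (i : ℕ) ≤ j := hij
      simp only [he]
      split_ifs <;> first | omega | norm_num)
    (by intro i hi; simp [hi]) (by intro i hi; simp [hi])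
  have hle : ∑ j, (min (u j) (1 - u j) - if (j : ℕ) < k then labelVal (y j)
      else 1 - labelVal (y j)) ≤ 0 := by
    refine le_trans (Finset.sum_le_sum fun j _ => ?_) h
    obtain ⟨hy0, hy1⟩ := labelVal_mem_Icc (y j)
    have hl := min_le_left (u j) (1 - u j)
    have hr := min_le_right (u j) (1 - u j)
    split_ifs with a b c d e <;> linarith
  rw [Finset.sum_sub_distrib] at hle
  unfold thresholdLoss
  linarith

theorem exists_threshold_of_lowerSet {n : ℕ} (p : Fin n → Prop)
    (hp : ∀ i j, i ≤ j → p j → p i) : ∃ k ≤ n, ∀ j : Fin n, (j : ℕ) < k ↔ p j := by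
  classical
  by_cases h : ∃ k, ∃ hk : k < n, ¬ p ⟨k, hk⟩
  · obtain ⟨hlt, hnot⟩ := Nat.find_spec h
    refine ⟨Nat.find h, hlt.le, fun j => ⟨fun hj => ?_, fun hj => ?_⟩⟩
    · by_contra hpj
      exact Nat.find_min h hj ⟨j.2, hpj⟩
    · by_contra hjk
      exact hnot (hp _ j (not_lt.1 hjk) hj)
  · push Not at h
    exact ⟨n, le_rfl, fun j => ⟨fun _ => h j j.2, fun _ => j.2⟩⟩

/-- The plug-in sum of the isotonic fit dominates the empirical error of the rule obtained by
thresholding the fit at `1 / 2`. -/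
theorem exists_thresholdLoss_le_sum_min_isotonicFit {n : ℕ} (y : Fin n → Bool) :
    ∃ k ≤ n, thresholdLoss (fun i => labelVal (y i)) k
      ≤ ∑ i, min (isotonicFit y i) (1 - isotonicFit y i) := by
  obtain ⟨hu, hmin⟩ := (exists_isotonicFit y).choose_spec
  change isotonicFit y ∈ _ at hu
  change IsMinOn _ _ (isotonicFit y) at hmin
  set u := isotonicFit y
  obtain ⟨k, hkn, hk⟩ := exists_threshold_of_lowerSet (fun j => u j < 1 / 2)
    (fun i j hij hj => (hu.1 hij).trans_lt hj)
  refine ⟨k, hkn, ?_⟩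
  have h1 := sum_residual_mul_le_zero hu hmin (fun j => if u j < 1 / 2 then 1 else -1)
    (by intro i j _ he; simp [he]) (by intro i hi; norm_num [hi]) (by intro i hi; norm_num [hi])
  have hle : ∑ j : Fin n, ((if (j : ℕ) < k then labelVal (y j) else 1 - labelVal (y j))
      - min (u j) (1 - u j)) ≤ 0 := by
    refine le_trans (Finset.sum_le_sum fun j _ => ?_) h1
    simp only [hk]
    split_ifs with h
    · rw [min_eq_left (by linarith)]; linarith
    · rw [min_eq_right (by linarith)]; linarith
  rw [Finset.sum_sub_distrib] at hle
  unfold thresholdLoss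
  linarith

/-! ### The Bayes error as an integral -/

section Bayes

variable {𝒳 : Type*} [MeasurableSpace 𝒳] (D : Measure (𝒳 × Bool))

theorem softLabel_mem_Icc [IsFiniteMeasure D] (x : 𝒳) : softLabel D x ∈ Set.Icc (0 : ℝ) 1 :=
  ⟨measureReal_nonneg, measureReal_le_one⟩

theorem measurable_softLabel [IsFiniteMeasure D] : Measurable (softLabel D) :=
  (Kernel.measurable_coe D.condKernel (MeasurableSet.singleton true)).ennreal_toReal

/-- The conditional error probability of the Bayes classifier at an instance. -/
noncomputable def pointwiseBayesError [IsFiniteMeasure D] (x : 𝒳) : ℝ :=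
  min (softLabel D x) (1 - softLabel D x)

theorem pointwiseBayesError_mem_Icc [IsFiniteMeasure D] (x : 𝒳) :
    pointwiseBayesError D x ∈ Set.Icc (0 : ℝ) 1 := by
  obtain ⟨h0, h1⟩ := softLabel_mem_Icc D x
  exact ⟨le_min h0 (sub_nonneg.2 h1), (min_le_left _ _).trans h1⟩

theorem measurable_pointwiseBayesError [IsFiniteMeasure D] :
    Measurable (pointwiseBayesError D) :=
  (measurable_softLabel D).min (measurable_const.sub (measurable_softLabel D))

theorem errorRate_eq_integral [IsProbabilityMeasure D] {h : 𝒳 → Bool} (hh : Measurable h) :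
    errorRate D h = ∫ x, (if h x then 1 - softLabel D x else softLabel D x) ∂D.fst := by
  have hS : MeasurableSet {p : 𝒳 × Bool | p.2 ≠ h p.1} :=
    (measurableSet_eq_fun measurable_snd (hh.comp measurable_fst)).compl
  unfold errorRate
  rw [← integral_indicator_one hS]
  rw [← Measure.integral_condKernel (f := {p : 𝒳 × Bool | p.2 ≠ h p.1}.indicator 1)
    ((integrable_const (1 : ℝ)).indicator hS)]
  refine integral_congr_ae (Filter.Eventually.of_forall fun x => ?_)
  have hx : ∀ b, {p : 𝒳 × Bool | p.2 ≠ h p.1}.indicator (1 : 𝒳 × Bool → ℝ) (x, b)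
      = {b | b ≠ h x}.indicator (1 : Bool → ℝ) b := fun b => rfl
  simp only [hx]
  rw [integral_indicator_one (Set.toFinite _).measurableSet]
  cases hb : h x
  · simp [softLabel]
  · have : {b : Bool | b ≠ true} = {true}ᶜ := by ext b; cases b <;> simp
    rw [this, probReal_compl_eq_one_sub (MeasurableSet.singleton true)]
    simp [softLabel]

theorem bayesError_eq_integral [IsProbabilityMeasure D] :
    bayesError D = ∫ x, pointwiseBayesError D x ∂D.fst := by
  have hη := measurable_softLabel D
  have hint : Integrable (pointwiseBayesError D) D.fst :=
    Integrable.of_mem_Icc 0 1 (measurable_pointwiseBayesError D).aemeasurable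
      (Filter.Eventually.of_forall (pointwiseBayesError_mem_Icc D))
  have hle : ∀ h : {h : 𝒳 → Bool // Measurable h},
      ∫ x, pointwiseBayesError D x ∂D.fst ≤ errorRate D h.1 := by
    rintro ⟨h, hh⟩
    rw [errorRate_eq_integral D hh]
    refine integral_mono hint (Integrable.of_mem_Icc 0 1 ?_ ?_) fun x => ?_
    · exact (Measurable.ite (hh (MeasurableSet.singleton true)) (measurable_const.sub hη)
        hη).aemeasurable
    · refine Filter.Eventually.of_forall fun x => ?_
      obtain ⟨h0, h1⟩ := softLabel_mem_Icc D x
      split_ifs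
      · exact ⟨by linarith, by linarith⟩
      · exact ⟨h0, h1⟩
    · simp only [pointwiseBayesError]
      split_ifs
      · exact min_le_right _ _
      · exact min_le_left _ _
  have : Nonempty {h : 𝒳 → Bool // Measurable h} := ⟨⟨fun _ => true, measurable_const⟩⟩
  refine le_antisymm ?_ (le_ciInf hle)
  have hs : MeasurableSet {x | 1 / 2 ≤ softLabel D x} := measurableSet_le measurable_const hη
  have hm : Measurable fun x => decide (1 / 2 ≤ softLabel D x) := by
    refine measurable_to_bool ?_
    convert hs using 1
    ext x
    simp
  refine (ciInf_le ⟨_, Set.forall_mem_range.2 hle⟩ ⟨_, hm⟩).trans_eq ?_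
  rw [errorRate_eq_integral D hm]
  refine integral_congr_ae (Filter.Eventually.of_forall fun x => ?_)
  simp only [pointwiseBayesError, decide_eq_true_eq]
  split_ifs with hx
  · rw [min_eq_right (by linarith)]
  · rw [min_eq_left (by linarith)]

end Bayes

/-! ### Concentration -/

/-- Hoeffding's inequality for independent variables with values in the unit interval. -/
theorem measureReal_sum_sub_integral_ge_le {Ω : Type*} [MeasurableSpace Ω] {P : Measure Ω}
    [IsProbabilityMeasure P] {n : ℕ} {Z : Fin n → Ω → ℝ} (hZ : ∀ i, Measurable (Z i))
    (hind : iIndepFun Z P) (hb : ∀ i ω, Z i ω ∈ Set.Icc (0 : ℝ) 1) {T : ℝ} (hT : 0 ≤ T) :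
    P.real {ω | T ≤ ∑ i, (Z i ω - ∫ ω, Z i ω ∂P)} ≤ Real.exp (-(2 * T ^ 2 / n)) := by
  have hind' := hind.comp (fun i z => z - ∫ ω, Z i ω ∂P) fun i => measurable_id.sub_const _
  have h := HasSubgaussianMGF.measure_sum_ge_le_of_iIndepFun hind' (s := Finset.univ)
    (c := fun _ => (‖(1 : ℝ) - 0‖₊ / 2) ^ 2)
    (fun i _ => hasSubgaussianMGF_of_mem_Icc (hZ i).aemeasurable
      (Filter.Eventually.of_forall (hb i))) hT
  refine h.trans_eq ?_
  congr 1
  simp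
  ring

theorem measureReal_sum_sub_integral_le_neg_le {Ω : Type*} [MeasurableSpace Ω] {P : Measure Ω}
    [IsProbabilityMeasure P] {n : ℕ} {Z : Fin n → Ω → ℝ} (hZ : ∀ i, Measurable (Z i))
    (hind : iIndepFun Z P) (hb : ∀ i ω, Z i ω ∈ Set.Icc (0 : ℝ) 1) {T : ℝ} (hT : 0 ≤ T) :
    P.real {ω | ∑ i, (Z i ω - ∫ ω, Z i ω ∂P) ≤ -T} ≤ Real.exp (-(2 * T ^ 2 / n)) := by
  have h := measureReal_sum_sub_integral_ge_le (Z := fun i ω => 1 - Z i ω)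
    (fun i => measurable_const.sub (hZ i))
    (hind.comp (fun _ z => 1 - z) fun i => measurable_const.sub measurable_id)
    (fun i ω => ⟨by linarith [(hb i ω).2], by linarith [(hb i ω).1]⟩) hT
  convert h using 3
  ext ω
  have : ∀ i, ∫ ω, (1 - Z i ω) ∂P = 1 - ∫ ω, Z i ω ∂P := fun i => by
    rw [integral_sub (integrable_const _) (Integrable.of_mem_Icc 0 1 (hZ i).aemeasurable
      (Filter.Eventually.of_forall (hb i)))]
    simp
  have hs : ∑ i, ((1 - Z i ω) - ∫ ω, (1 - Z i ω) ∂P) = -∑ i, (Z i ω - ∫ ω, Z i ω ∂P) := by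
    rw [← Finset.sum_neg_distrib]
    exact Finset.sum_congr rfl fun i _ => by rw [this]; ring
  simp only [hs]
  exact le_neg

/-- The moment generating function of a scaled centred Bernoulli variable. By convexity `exp`
lies below its chord on `[-l, l]`, so the worst case is a symmetric sign. -/
theorem bernoulli_mgf_le {p a : ℝ} (hp : p ∈ Set.Icc (0 : ℝ) 1) (ha : |a| ≤ 1) (l : ℝ) :
    p * Real.exp (l * (a * (1 - p))) + (1 - p) * Real.exp (l * (a * (0 - p)))
      ≤ Real.exp (l ^ 2 / 2) := by
  have chord : ∀ z : ℝ, |z| ≤ 1 → Real.exp (l * z) ≤ Real.cosh l + z * Real.sinh l := by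
    intro z hz
    obtain ⟨hz1, hz2⟩ := abs_le.1 hz
    have h := convexOn_exp.2 (Set.mem_univ l) (Set.mem_univ (-l))
      (show 0 ≤ (1 + z) / 2 by linarith) (show 0 ≤ (1 - z) / 2 by linarith) (by ring)
    simp only [smul_eq_mul] at h
    rw [Real.cosh_eq, Real.sinh_eq]
    calc Real.exp (l * z) = Real.exp ((1 + z) / 2 * l + (1 - z) / 2 * -l) := by congr 1; ring
      _ ≤ _ := h
      _ = _ := by ring
  obtain ⟨h0, h1⟩ := hp
  have e1 := chord (a * (1 - p)) (by
    rw [abs_mul]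
    exact mul_le_one₀ ha (abs_nonneg _) (abs_le.2 ⟨by linarith, by linarith⟩))
  have e2 := chord (a * (0 - p)) (by
    rw [abs_mul]
    exact mul_le_one₀ ha (abs_nonneg _) (abs_le.2 ⟨by linarith, by linarith⟩))
  refine le_trans ?_ (Real.cosh_le_exp_half_sq l)
  have := mul_le_mul_of_nonneg_left e1 h0
  have := mul_le_mul_of_nonneg_left e2 (sub_nonneg.2 h1)
  nlinarith

section Labels

variable {𝒳 Ω : Type*} [MeasurableSpace 𝒳] [MeasurableSpace Ω] {D : Measure (𝒳 × Bool)}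
  [IsProbabilityMeasure D] {P : Measure Ω} [IsProbabilityMeasure P] {n : ℕ}
  {X : Fin n → Ω → 𝒳} {Y : Fin n → Ω → Bool} {ε : Fin n → Ω → ℝ}

/-- Against a function of the instances and the noise, the indicator of a label vector may be
replaced by its conditional probability. -/
theorem integral_mul_indicator_labels (hX : ∀ i, Measurable (X i)) (hY : ∀ i, Measurable (Y i))
    (hε : ∀ i, Measurable (ε i)) (hlab : LabelsFromPosterior D P X Y ε) (y : Fin n → Bool)
    {G : (Fin n → 𝒳) × (Fin n → ℝ) → ℝ} (hG : Measurable G) {K : ℝ} (hK : ∀ z, ‖G z‖ ≤ K) :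
    ∫ ω, G (fun i => X i ω, fun i => ε i ω) *
        Set.indicator {ω | ∀ i, Y i ω = y i} (fun _ => (1 : ℝ)) ω ∂P
      = ∫ ω, G (fun i => X i ω, fun i => ε i ω) *
        ∏ i, (if y i then softLabel D (X i ω) else 1 - softLabel D (X i ω)) ∂P := by
  have hφ : Measurable fun ω => ((fun i => X i ω), (fun i => ε i ω)) :=
    (measurable_pi_iff.2 hX).prodMk (measurable_pi_iff.2 hε)
  have hS : MeasurableSet {ω | ∀ i, Y i ω = y i} := by
    have : {ω | ∀ i, Y i ω = y i} = ⋂ i, Y i ⁻¹' {y i} := by ext; simp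
    rw [this]
    exact MeasurableSet.iInter fun i => hY i (MeasurableSet.singleton _)
  have hGm : StronglyMeasurable[MeasurableSpace.comap
      (fun ω => ((fun i => X i ω), (fun i => ε i ω))) inferInstance]
      fun ω => G (fun i => X i ω, fun i => ε i ω) :=
    (hG.comp (comap_measurable _)).stronglyMeasurable
  have hpull := condExp_stronglyMeasurable_mul_of_bound hφ.comap_le hGm
    ((integrable_const (1 : ℝ)).indicator hS (μ := P)) K
    (Filter.Eventually.of_forall fun ω => hK _)
  have hint := integral_condExp hφ.comap_le (μ := P)
    (f := (fun ω => G (fun i => X i ω, fun i => ε i ω)) *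
      Set.indicator {ω | ∀ i, Y i ω = y i} (fun _ => (1 : ℝ)))
  refine hint.symm.trans (integral_congr_ae ?_)
  filter_upwards [hpull, hlab y] with ω h1 h2
  rw [h1, Pi.mul_apply, h2]

/-- Conditionally on the instances and the noise, a weighted sum of the centred labels is
sub-Gaussian; the weights may depend on the instances and the noise, as those produced by sorting
the scores do. -/
theorem integral_exp_labelSum_le (hX : ∀ i, Measurable (X i)) (hY : ∀ i, Measurable (Y i))
    (hε : ∀ i, Measurable (ε i)) (hlab : LabelsFromPosterior D P X Y ε)
    {A : (Fin n → 𝒳) × (Fin n → ℝ) → Fin n → ℝ} (hA : Measurable A) (hA1 : ∀ z i, |A z i| ≤ 1)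
    (l : ℝ) :
    ∫ ω, Real.exp (l * ∑ i, A (fun i => X i ω, fun i => ε i ω) i *
        (labelVal (Y i ω) - softLabel D (X i ω))) ∂P ≤ Real.exp (n * (l ^ 2 / 2)) := by
  classical
  set φ : Ω → (Fin n → 𝒳) × (Fin n → ℝ) := fun ω => (fun i => X i ω, fun i => ε i ω) with hφdef
  have hφ : Measurable φ := (measurable_pi_iff.2 hX).prodMk (measurable_pi_iff.2 hε)
  have hη := measurable_softLabel D
  have habs : ∀ (b : Bool) (x : 𝒳), |labelVal b - softLabel D x| ≤ 1 := fun b x => by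
    obtain ⟨h0, h1⟩ := softLabel_mem_Icc D x
    obtain ⟨h2, h3⟩ := labelVal_mem_Icc b
    exact abs_le.2 ⟨by linarith, by linarith⟩
  let G : (Fin n → Bool) → (Fin n → 𝒳) × (Fin n → ℝ) → ℝ := fun y z =>
    Real.exp (l * ∑ i, A z i * (labelVal (y i) - softLabel D (z.1 i)))
  have hGm : ∀ y, Measurable (G y) := fun y => by
    refine Real.measurable_exp.comp (measurable_const.mul (Finset.measurable_sum _ fun i _ => ?_))
    exact ((measurable_pi_apply i).comp hA).mul (measurable_const.sub
      (hη.comp ((measurable_pi_apply i).comp measurable_fst)))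
  have hGb : ∀ y z, ‖G y z‖ ≤ Real.exp (|l| * n) := fun y z => by
    rw [Real.norm_eq_abs, Real.abs_exp]
    refine Real.exp_le_exp.2 ((le_abs_self _).trans ?_)
    rw [abs_mul]
    refine mul_le_mul_of_nonneg_left ?_ (abs_nonneg _)
    refine (Finset.abs_sum_le_sum_abs _ _).trans ?_
    refine (Finset.sum_le_sum (g := fun _ => (1 : ℝ)) fun i _ => ?_).trans (by simp)
    rw [abs_mul]
    exact mul_le_one₀ (hA1 z i) (abs_nonneg _) (habs _ _)
  have hS : ∀ y : Fin n → Bool, MeasurableSet {ω | ∀ i, Y i ω = y i} := fun y => by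
    have : {ω | ∀ i, Y i ω = y i} = ⋂ i, Y i ⁻¹' {y i} := by ext; simp
    rw [this]
    exact MeasurableSet.iInter fun i => hY i (MeasurableSet.singleton _)
  have hsplit : ∀ ω, Real.exp (l * ∑ i, A (φ ω) i * (labelVal (Y i ω) - softLabel D (X i ω)))
      = ∑ y, G y (φ ω) * Set.indicator {ω | ∀ i, Y i ω = y i} (fun _ => (1 : ℝ)) ω := by
    intro ω
    rw [Finset.sum_eq_single (fun i => Y i ω)]
    · simp [G, φ, Set.indicator]
    · intro y _ hy
      have : ¬ ∀ i, Y i ω = y i := fun h => hy (funext fun i => (h i).symm)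
      simp [this]
    · simp
  have hInt1 : ∀ y, Integrable (fun ω => G y (φ ω) *
      Set.indicator {ω | ∀ i, Y i ω = y i} (fun _ => (1 : ℝ)) ω) P := fun y =>
    ((integrable_const (1 : ℝ)).indicator (hS y)).bdd_mul
      ((hGm y).comp hφ).aestronglyMeasurable (Filter.Eventually.of_forall fun ω => hGb y _)
  have hq : ∀ (b : Bool) (x : 𝒳), 0 ≤ (if b then softLabel D x else 1 - softLabel D x) ∧
      (if b then softLabel D x else 1 - softLabel D x) ≤ 1 := fun b x => by
    obtain ⟨h0, h1⟩ := softLabel_mem_Icc D x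
    split_ifs <;> constructor <;> linarith
  have hqm : ∀ y : Fin n → Bool, Measurable fun ω =>
      ∏ i, (if y i then softLabel D (X i ω) else 1 - softLabel D (X i ω)) := fun y => by
    refine Finset.measurable_prod _ fun i _ => ?_
    split_ifs
    · exact hη.comp (hX i)
    · exact measurable_const.sub (hη.comp (hX i))
  have hInt2 : ∀ y, Integrable (fun ω => G y (φ ω) *
      ∏ i, (if y i then softLabel D (X i ω) else 1 - softLabel D (X i ω))) P := fun y => by
    refine Integrable.bdd_mul (Integrable.of_mem_Icc 0 1 (hqm y).aemeasurable
      (Filter.Eventually.of_forall fun ω => ⟨?_, ?_⟩)) ((hGm y).comp hφ).aestronglyMeasurable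
      (Filter.Eventually.of_forall fun ω => hGb y _)
    · exact Finset.prod_nonneg fun i _ => (hq _ _).1
    · exact Finset.prod_le_one (fun i _ => (hq _ _).1) fun i _ => (hq _ _).2
  calc ∫ ω, Real.exp (l * ∑ i, A (φ ω) i * (labelVal (Y i ω) - softLabel D (X i ω))) ∂P
      = ∑ y, ∫ ω, G y (φ ω) *
          Set.indicator {ω | ∀ i, Y i ω = y i} (fun _ => (1 : ℝ)) ω ∂P := by
        simp only [hsplit]
        exact integral_finsetSum _ fun y _ => hInt1 y
    _ = ∑ y, ∫ ω, G y (φ ω) *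
          ∏ i, (if y i then softLabel D (X i ω) else 1 - softLabel D (X i ω)) ∂P :=
        Finset.sum_congr rfl fun y _ =>
          integral_mul_indicator_labels hX hY hε hlab y (hGm y) (hGb y)
    _ = ∫ ω, ∑ y, G y (φ ω) *
          ∏ i, (if y i then softLabel D (X i ω) else 1 - softLabel D (X i ω)) ∂P :=
        (integral_finsetSum _ fun y _ => hInt2 y).symm
    _ ≤ ∫ _, Real.exp (n * (l ^ 2 / 2)) ∂P := by
        refine integral_mono (integrable_finsetSum _ fun y _ => hInt2 y) (integrable_const _)
          fun ω => ?_
        have hfac : ∀ y, G y (φ ω) *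
            ∏ i, (if y i then softLabel D (X i ω) else 1 - softLabel D (X i ω))
            = ∏ i, Real.exp (l * (A (φ ω) i * (labelVal (y i) - softLabel D (X i ω)))) *
              (if y i then softLabel D (X i ω) else 1 - softLabel D (X i ω)) := fun y => by
          rw [Finset.prod_mul_distrib, ← Real.exp_sum, ← Finset.mul_sum]
        simp only [hfac]
        -- the conditional law of the labels is a product, so the sum over label vectors factors
        rw [← Fintype.prod_sum (fun i b => Real.exp (l * (A (φ ω) i *
          (labelVal b - softLabel D (X i ω)))) *
            (if b then softLabel D (X i ω) else 1 - softLabel D (X i ω))), Real.exp_nat_mul]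
        refine (Finset.prod_le_prod (fun i _ => Finset.sum_nonneg fun b _ =>
          mul_nonneg (Real.exp_pos _).le (hq b _).1) fun i _ => ?_).trans_eq
          (by rw [Finset.prod_const, Finset.card_univ, Fintype.card_fin])
        have := bernoulli_mgf_le (softLabel_mem_Icc D (X i ω)) (hA1 (φ ω) i) l
        simp only [Fintype.sum_bool, labelVal, if_true, Bool.false_eq_true, if_false]
        linarith
    _ = Real.exp (n * (l ^ 2 / 2)) := by simp

theorem measureReal_labelSum_ge_le (hn : 1 ≤ n) (hX : ∀ i, Measurable (X i))
    (hY : ∀ i, Measurable (Y i)) (hε : ∀ i, Measurable (ε i))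
    (hlab : LabelsFromPosterior D P X Y ε)
    {A : (Fin n → 𝒳) × (Fin n → ℝ) → Fin n → ℝ} (hA : Measurable A) (hA1 : ∀ z i, |A z i| ≤ 1)
    {T : ℝ} (hT : 0 ≤ T) :
    P.real {ω | T ≤ ∑ i, A (fun i => X i ω, fun i => ε i ω) i *
        (labelVal (Y i ω) - softLabel D (X i ω))} ≤ Real.exp (-(T ^ 2 / (2 * n))) := by
  have hn0 : (0 : ℝ) < n := by exact_mod_cast hn
  have hφ : Measurable fun ω => ((fun i => X i ω), (fun i => ε i ω)) :=
    (measurable_pi_iff.2 hX).prodMk (measurable_pi_iff.2 hε)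
  have hSm : Measurable fun ω => ∑ i, A (fun i => X i ω, fun i => ε i ω) i *
      (labelVal (Y i ω) - softLabel D (X i ω)) :=
    Finset.measurable_sum _ fun i _ => ((measurable_pi_apply i).comp (hA.comp hφ)).mul
      (((measurable_of_finite labelVal).comp (hY i)).sub
        ((measurable_softLabel D).comp (hX i)))
  have hSb : ∀ ω, |∑ i, A (fun i => X i ω, fun i => ε i ω) i *
      (labelVal (Y i ω) - softLabel D (X i ω))| ≤ n := fun ω => by
    refine (Finset.abs_sum_le_sum_abs _ _).trans ?_
    refine (Finset.sum_le_sum (g := fun _ => (1 : ℝ)) fun i _ => ?_).trans (by simp)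
    obtain ⟨h0, h1⟩ := softLabel_mem_Icc D (X i ω)
    obtain ⟨h2, h3⟩ := labelVal_mem_Icc (Y i ω)
    rw [abs_mul]
    exact mul_le_one₀ (hA1 _ i) (abs_nonneg _) (abs_le.2 ⟨by linarith, by linarith⟩)
  have hl : 0 ≤ T / n := by positivity
  refine (measure_ge_le_exp_mul_mgf T hl ?_).trans ?_
  · refine Integrable.of_mem_Icc 0 (Real.exp (T / n * n))
      (Real.measurable_exp.comp (measurable_const.mul hSm)).aemeasurable
      (Filter.Eventually.of_forall fun ω => ⟨(Real.exp_pos _).le, ?_⟩)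
    exact Real.exp_le_exp.2 (mul_le_mul_of_nonneg_left ((le_abs_self _).trans (hSb ω)) hl)
  · refine (mul_le_mul_of_nonneg_left (integral_exp_labelSum_le hX hY hε hlab hA hA1 (T / n))
      (Real.exp_pos _).le).trans_eq ?_
    rw [← Real.exp_add]
    congr 1
    field_simp
    ring

end Labels

/-! ### Stability of the threshold loss -/

/-- The coefficient of `p j` in `thresholdLoss p k`. -/
def thresholdSign {n : ℕ} (k : ℕ) (j : Fin n) : ℝ := if (j : ℕ) < k then 1 else -1

theorem abs_thresholdSign {n : ℕ} (k : ℕ) (j : Fin n) : |thresholdSign k j| = 1 := by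
  unfold thresholdSign
  split_ifs <;> simp

theorem thresholdLoss_sub_thresholdLoss {n : ℕ} (p q : Fin n → ℝ) (k : ℕ) :
    thresholdLoss p k - thresholdLoss q k = ∑ j, thresholdSign k j * (p j - q j) := by
  unfold thresholdLoss thresholdSign
  rw [← Finset.sum_sub_distrib]
  refine Finset.sum_congr rfl fun j _ => ?_
  split_ifs <;> ring

theorem sum_min_le_thresholdLoss {n : ℕ} (p : Fin n → ℝ) (k : ℕ) :
    ∑ j, min (p j) (1 - p j) ≤ thresholdLoss p k := by
  refine Finset.sum_le_sum fun j _ => ?_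
  split_ifs
  · exact min_le_left _ _
  · exact min_le_right _ _

/-- Thresholding the corrupted scores at `f (1 / 2)` is nearly optimal for the clean soft labels:
a position is put on the wrong side only if its noise exceeds `c * |p j - 1 / 2|`, and the excess
loss there is `2 * |p j - 1 / 2|`. -/
theorem exists_thresholdLoss_le_of_corruption {n : ℕ} {c : ℝ} (hc : 0 < c) {f : ℝ → ℝ}
    (hf : ∀ a ∈ Set.Icc (0 : ℝ) 1, ∀ b ∈ Set.Icc (0 : ℝ) 1, a ≤ b → c * (b - a) ≤ f b - f a)
    {p e : Fin n → ℝ} (hp : ∀ j, p j ∈ Set.Icc (0 : ℝ) 1)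
    (hs : Monotone fun j => f (p j) + e j) :
    ∃ k ≤ n, thresholdLoss p k
      ≤ ∑ j, min (p j) (1 - p j) + 2 * ∑ j, min (|e j| / c) 1 := by
  obtain ⟨k, hkn, hk⟩ := exists_threshold_of_lowerSet (fun j => f (p j) + e j < f (1 / 2))
    (fun i j hij hj => (hs hij).trans_lt hj)
  refine ⟨k, hkn, ?_⟩
  have half : (1 / 2 : ℝ) ∈ Set.Icc (0 : ℝ) 1 := by constructor <;> norm_num
  rw [Finset.mul_sum, ← Finset.sum_add_distrib]
  refine Finset.sum_le_sum fun j _ => ?_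
  obtain ⟨h0, h1⟩ := hp j
  have hpos : 0 ≤ min (|e j| / c) 1 := by positivity
  simp only [hk]
  split_ifs with h
  · rcases le_total (p j) (1 / 2) with hj | hj
    · rw [min_eq_left (a := p j) (by linarith)]; linarith
    · have h2 := hf _ half _ (hp j) hj
      have h3 := neg_abs_le (e j)
      have : p j - 1 / 2 ≤ min (|e j| / c) 1 :=
        le_min ((le_div_iff₀ hc).2 (by linarith)) (by linarith)
      rw [min_eq_right (a := p j) (by linarith)]; linarith
  · rcases le_total (p j) (1 / 2) with hj | hj
    · have h2 := hf _ (hp j) _ half hj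
      have h3 := le_abs_self (e j)
      have : 1 / 2 - p j ≤ min (|e j| / c) 1 :=
        le_min ((le_div_iff₀ hc).2 (by linarith)) (by linarith)
      rw [min_eq_left (a := p j) (by linarith)]; linarith
    · rw [min_eq_right (a := p j) (by linarith)]; linarith

/-- The deterministic core: if the labels deviate from the soft labels by at most `T` along every
threshold, the plug-in sum of the isotonic fit is within `T`, plus twice the truncated noise, of
the plug-in sum of the clean soft labels. -/
theorem abs_sum_min_isotonicFit_sub_le {n : ℕ} {c : ℝ} (hc : 0 < c) {f : ℝ → ℝ}
    (hf : ∀ a ∈ Set.Icc (0 : ℝ) 1, ∀ b ∈ Set.Icc (0 : ℝ) 1, a ≤ b → c * (b - a) ≤ f b - f a)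
    {p e : Fin n → ℝ} (hp : ∀ j, p j ∈ Set.Icc (0 : ℝ) 1)
    (hs : Monotone fun j => f (p j) + e j) (y : Fin n → Bool) {T : ℝ}
    (hT : ∀ k ≤ n, |∑ j, thresholdSign k j * (labelVal (y j) - p j)| ≤ T) :
    |∑ j, min (isotonicFit y j) (1 - isotonicFit y j) - ∑ j, min (p j) (1 - p j)|
      ≤ T + 2 * ∑ j, min (|e j| / c) 1 := by
  have hZ : 0 ≤ ∑ j, min (|e j| / c) 1 := Finset.sum_nonneg fun j _ => by positivity
  obtain ⟨k, hkn, hk⟩ := exists_thresholdLoss_le_of_corruption hc hf hp hs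
  obtain ⟨m, hmn, hm⟩ := exists_thresholdLoss_le_sum_min_isotonicFit y
  have h1 := sum_min_isotonicFit_le y k
  have h2 := sum_min_le_thresholdLoss p m
  have hTk := abs_le.1 (hT k hkn)
  have hTm := abs_le.1 (hT m hmn)
  rw [← thresholdLoss_sub_thresholdLoss (fun j => labelVal (y j))] at hTk hTm
  exact abs_le.2 ⟨by linarith, by linarith⟩

/-! ### The error bound -/

theorem integral_min_abs_div_le {Ω : Type*} [MeasurableSpace Ω] {P : Measure Ω}
    [IsProbabilityMeasure P] {e : Ω → ℝ} (he : Measurable e) (hL : MemLp e 2 P)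
    (h0 : ∫ ω, e ω ∂P = 0) {σ c : ℝ} (hσ : 0 ≤ σ) (hv : variance e P ≤ σ ^ 2) (hc : 0 < c) :
    ∫ ω, min (|e ω| / c) 1 ∂P ≤ σ / c := by
  have hint : Integrable e P := hL.integrable (by norm_num)
  have habs : ∫ ω, |e ω| ∂P ≤ σ := by
    have h := variance_eq_sub hL.abs
    have h' := variance_nonneg (fun ω => |e ω|) P
    rw [variance_of_integral_eq_zero he.aemeasurable h0] at hv
    have hsq : P[(fun ω => |e ω|) ^ 2] = ∫ ω, e ω ^ 2 ∂P :=
      integral_congr_ae (Filter.Eventually.of_forall fun ω => by simp)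
    exact abs_le_of_sq_le_sq' (by simp only [Pi.abs_def] at *; linarith) hσ |>.2
  calc ∫ ω, min (|e ω| / c) 1 ∂P ≤ ∫ ω, |e ω| / c ∂P := by
        refine integral_mono (Integrable.of_mem_Icc 0 1
          (((he.abs).div_const c).min measurable_const).aemeasurable
          (Filter.Eventually.of_forall fun ω => ⟨by positivity, min_le_right _ _⟩))
          (hint.abs.div_const c) fun ω => min_le_left _ _
    _ = (∫ ω, |e ω| ∂P) / c := integral_div _ _
    _ ≤ σ / c := by gcongr

/-- The union bound over all thresholds costs a factor linear in `n`, which the `n ^ (-1 / 3)` part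
of the deviation absorbs. -/
theorem mul_exp_neg_deviation_le {n : ℕ} (hn : 1 ≤ n) {δ : ℝ} (hδ : 0 < δ) (hδ1 : δ < 1) {t : ℝ}
    (ht : t = 4 * (1 / (n : ℝ) ^ (1 / 3 : ℝ)) + 2 * Real.sqrt (Real.log (1 / δ) / n)) :
    (2 * n + 5) * Real.exp (-((n * t) ^ 2 / (2 * n))) ≤ δ := by
  have hn1 : (1 : ℝ) ≤ n := by exact_mod_cast hn
  have hn0 : (0 : ℝ) < n := by linarith
  obtain ⟨q, hq⟩ : ∃ q : ℝ, q = (n : ℝ) ^ (1 / 3 : ℝ) := ⟨_, rfl⟩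
  have hq1 : 1 ≤ q := hq ▸ Real.one_le_rpow hn1 (by norm_num)
  have hq3 : q ^ 3 = n := by
    rw [hq, ← Real.rpow_natCast, ← Real.rpow_mul hn0.le]
    norm_num
  have hq0 : 0 < q := by linarith
  obtain ⟨L, hL⟩ : ∃ L, L = Real.log (1 / δ) := ⟨_, rfl⟩
  have hL0 : 0 ≤ L := hL ▸ Real.log_nonneg ((one_le_div hδ).2 hδ1.le)
  obtain ⟨r, hr⟩ : ∃ r, r = Real.sqrt (L / n) := ⟨_, rfl⟩
  have hr0 : 0 ≤ r := hr ▸ Real.sqrt_nonneg _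
  have hr2 : n * r ^ 2 = L := by
    rw [hr, Real.sq_sqrt (by positivity)]
    field_simp
  rw [← hq, ← hL, ← hr] at ht
  -- with `q = n ^ (1 / 3)`, the exponent pays `δ` through `L` and the factor `2 * n + 5` through
  -- `8 * q`, because `exp (8 * q) ≥ (2 * q + 1) ^ 4` and `n = q ^ 3`
  have hexp : 8 * q + L ≤ (n * t) ^ 2 / (2 * n) := by
    have h1 : (n * t) ^ 2 / (2 * n) = n * t ^ 2 / 2 := by field_simp
    have h2 : n * (4 * (1 / q)) ^ 2 = 16 * q := by
      rw [← hq3]; field_simp; norm_num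
    have h3 : (4 * (1 / q)) ^ 2 + 4 * r ^ 2 ≤ t ^ 2 := by
      have : 0 ≤ 1 / q * r := by positivity
      rw [ht]; nlinarith
    have h4 := mul_le_mul_of_nonneg_left h3 hn0.le
    rw [h1]
    linarith
  have hδL : Real.exp (-L) = δ := by
    rw [hL, one_div, Real.log_inv, neg_neg, Real.exp_log hδ]
  have hpoly : 2 * n + 5 ≤ Real.exp (8 * q) := by
    have h1 : (2 * q + 1) ^ 4 ≤ Real.exp (8 * q) := by
      have : Real.exp (8 * q) = Real.exp (2 * q) ^ 4 := by
        rw [← Real.exp_nat_mul]; congr 1; push_cast; ring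
      rw [this]
      exact pow_le_pow_left₀ (by positivity) (Real.add_one_le_exp _) 4
    have : 0 ≤ q ^ 4 := by positivity
    rw [← hq3]
    nlinarith [sq_nonneg q]
  calc (2 * n + 5) * Real.exp (-((n * t) ^ 2 / (2 * n)))
      ≤ Real.exp (8 * q) * Real.exp (-(8 * q + L)) := by gcongr
    _ = Real.exp (-L) := by rw [← Real.exp_add]; congr 1; ring
    _ = δ := hδL

theorem measurable_comp_sortingRule {α : Type*} [MeasurableSpace α] {n : ℕ} (τ : SortingRule n)
    {s : α → Fin n → ℝ} (hs : Measurable s) (F : Equiv.Perm (Fin n) → Fin n → ℝ) :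
    Measurable fun z => F (τ.perm (s z)) := by
  let _ : MeasurableSpace (Equiv.Perm (Fin n)) := ⊤
  have h : Measurable fun z => τ.perm (s z) :=
    measurable_to_countable' fun π => hs (τ.measurable π)
  exact measurable_from_top.comp h

theorem mainTheorem3 (c : ℝ) (hc : 0 < c) :
    ∃ C' : ℝ, 0 < C' ∧
      ∀ (𝒳 : Type*) [MeasurableSpace 𝒳] (D : Measure (𝒳 × Bool)) [IsProbabilityMeasure D]
        (Ω : Type*) [MeasurableSpace Ω] (P : Measure Ω) [IsProbabilityMeasure P]
        (n : ℕ) (_ : 1 ≤ n)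
        (X : Fin n → Ω → 𝒳) (Y : Fin n → Ω → Bool) (ε : Fin n → Ω → ℝ)
        (_ : ∀ i, Measurable (X i)) (_ : ∀ i, Measurable (Y i)) (_ : ∀ i, Measurable (ε i))
        -- the instances are i.i.d. with the marginal distribution of `D`
        (_ : iIndepFun X P) (_ : ∀ i, P.map (X i) = D.fst)
        -- independent zero-mean noise variables with variance at most `σ ^ 2`
        (σ : ℝ) (_ : 0 ≤ σ) (_ : iIndepFun ε P)
        (_ : ∀ i, MemLp (ε i) 2 P) (_ : ∀ i, ∫ ω, ε i ω ∂P = 0)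
        (_ : ∀ i, variance (ε i) P ≤ σ ^ 2)
        -- the hard labels are drawn from the true posterior
        (_ : LabelsFromPosterior D P X Y ε)
        -- the corruption function
        (f : ℝ → ℝ) (_ : ContinuousOn f (Set.Icc 0 1))
        (_ : DifferentiableOn ℝ f (Set.Ioo 0 1)) (_ : ∀ t ∈ Set.Ioo (0 : ℝ) 1, c ≤ deriv f t)
        (τ : SortingRule n) (δ : ℝ) (_ : 0 < δ) (_ : δ < 1),
        1 - δ ≤ P.real {ω |
          |isotonicEstimator τ (fun i => f (softLabel D (X i ω)) + ε i ω) (fun i => Y i ω)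
              - bayesError D|
            ≤ C' * (σ + 1 / (n : ℝ) ^ (1 / 3 : ℝ) + Real.sqrt (Real.log (1 / δ) / n))} := by
  refine ⟨2 / c + 16, by positivity, ?_⟩
  intro 𝒳 _ D _ Ω _ P _ n hn X Y ε hX hY hε hXind hXlaw σ hσ hεind hεL hε0 hεv hlab f hfc hfd hf'
    τ δ hδ hδ1
  have hn0 : (0 : ℝ) < n := by exact_mod_cast hn
  obtain ⟨t, ht⟩ : ∃ t : ℝ, t = 4 * (1 / (n : ℝ) ^ (1 / 3 : ℝ))
      + 2 * Real.sqrt (Real.log (1 / δ) / n) := ⟨_, rfl⟩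
  have ht0 : 0 ≤ t := by rw [ht]; positivity
  have hT0 : 0 ≤ n * t := by positivity
  have hf : ∀ a ∈ Set.Icc (0 : ℝ) 1, ∀ b ∈ Set.Icc (0 : ℝ) 1, a ≤ b → c * (b - a) ≤ f b - f a :=
    (convex_Icc 0 1).mul_sub_le_image_sub_of_le_deriv hfc (by rwa [interior_Icc])
      (by rwa [interior_Icc])
  have hη := measurable_softLabel D
  have hfη : Measurable fun x => f (softLabel D x) := by
    have hcont : Continuous (Set.IccExtend (zero_le_one (α := ℝ)) ((Set.Icc 0 1).domRestrict f)) :=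
      hfc.domRestrict.Icc_extend'
    have : (fun x => f (softLabel D x))
        = fun x => Set.IccExtend zero_le_one ((Set.Icc 0 1).domRestrict f) (softLabel D x) := by
      ext x
      rw [Set.IccExtend_of_mem _ _ (softLabel_mem_Icc D x)]
      rfl
    rw [this]
    exact hcont.measurable.comp hη
  -- the weights of the labels in the threshold loss of the sorted sequence, in the original order
  let s : (Fin n → 𝒳) × (Fin n → ℝ) → Fin n → ℝ := fun z i => f (softLabel D (z.1 i)) + z.2 i
  have hs : Measurable s := measurable_pi_iff.2 fun i =>
    (hfη.comp ((measurable_pi_apply i).comp measurable_fst)).add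
      ((measurable_pi_apply i).comp measurable_snd)
  let A : ℕ → (Fin n → 𝒳) × (Fin n → ℝ) → Fin n → ℝ :=
    fun k z i => thresholdSign k ((τ.perm (s z)).symm i)
  have hA : ∀ k, Measurable (A k) := fun k =>
    measurable_comp_sortingRule τ hs fun π i => thresholdSign k (π.symm i)
  have hA1 : ∀ k z i, |A k z i| ≤ 1 := fun k z i => (abs_thresholdSign _ _).le
  let φ : Ω → (Fin n → 𝒳) × (Fin n → ℝ) := fun ω => (fun i => X i ω, fun i => ε i ω)
  let N : ℕ → Ω → ℝ := fun k ω =>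
    ∑ i, A k (φ ω) i * (labelVal (Y i ω) - softLabel D (X i ω))
  let W : Fin n → Ω → ℝ := fun i ω => pointwiseBayesError D (X i ω)
  let Z : Fin n → Ω → ℝ := fun i ω => min (|ε i ω| / c) 1
  have hW : ∀ i, ∫ ω, W i ω ∂P = bayesError D := fun i => by
    rw [bayesError_eq_integral, ← hXlaw i, integral_map (hX i).aemeasurable
      (measurable_pointwiseBayesError D).aestronglyMeasurable]
  have hWm : ∀ i, Measurable (W i) := fun i => (measurable_pointwiseBayesError D).comp (hX i)
  have hWb : ∀ i ω, W i ω ∈ Set.Icc (0 : ℝ) 1 := fun i ω => pointwiseBayesError_mem_Icc D _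
  have hWind : iIndepFun W P :=
    hXind.comp (fun _ => pointwiseBayesError D) fun _ => measurable_pointwiseBayesError D
  have hZ' : Measurable fun e : ℝ => min (|e| / c) 1 :=
    (measurable_abs.div_const c).min measurable_const
  have hZm : ∀ i, Measurable (Z i) := fun i => hZ'.comp (hε i)
  have hZb : ∀ i ω, Z i ω ∈ Set.Icc (0 : ℝ) 1 := fun i ω =>
    ⟨by positivity, min_le_right _ _⟩
  have hZind : iIndepFun Z P := hεind.comp (fun _ e => min (|e| / c) 1) fun _ => hZ'
  have hZi : ∀ i, ∫ ω, Z i ω ∂P ≤ σ / c := fun i =>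
    integral_min_abs_div_le (hε i) (hεL i) (hε0 i) hσ (hεv i) hc
  let B₁ : Set Ω := {ω | n * t ≤ ∑ i, (W i ω - ∫ ω, W i ω ∂P)}
  let B₂ : Set Ω := {ω | ∑ i, (W i ω - ∫ ω, W i ω ∂P) ≤ -(n * t)}
  let B₃ : Set Ω := {ω | n * t ≤ ∑ i, (Z i ω - ∫ ω, Z i ω ∂P)}
  let B₄ : ℕ → Set Ω := fun k => {ω | n * t ≤ N k ω}
  let B₅ : ℕ → Set Ω := fun k => {ω | n * t ≤ -N k ω}
  let B : Set Ω := (B₁ ∪ B₂) ∪ B₃ ∪ ⋃ k ∈ Finset.range (n + 1), (B₄ k ∪ B₅ k)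
  have hB : P.real B ≤ δ := by
    refine le_trans ?_ (mul_exp_neg_deviation_le hn hδ hδ1 ht)
    set E := Real.exp (-((n * t) ^ 2 / (2 * n))) with hE
    have hE' : Real.exp (-(2 * (n * t) ^ 2 / n)) ≤ E := by
      refine Real.exp_le_exp.2 (neg_le_neg ?_)
      have h1 : (n * t) ^ 2 / (2 * n) = n * t ^ 2 / 2 := by field_simp
      have h2 : 2 * (n * t) ^ 2 / n = 2 * (n * t ^ 2) := by field_simp
      have : 0 ≤ n * t ^ 2 := by positivity
      rw [h1, h2]
      linarith
    have h₁ : P.real B₁ ≤ E := (measureReal_sum_sub_integral_ge_le hWm hWind hWb hT0).trans hE'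
    have h₂ : P.real B₂ ≤ E :=
      (measureReal_sum_sub_integral_le_neg_le hWm hWind hWb hT0).trans hE'
    have h₃ : P.real B₃ ≤ E := (measureReal_sum_sub_integral_ge_le hZm hZind hZb hT0).trans hE'
    have h₄ : ∀ k, P.real (B₄ k) ≤ E := fun k =>
      measureReal_labelSum_ge_le hn hX hY hε hlab (hA k) (hA1 k) hT0
    have h₅ : ∀ k, P.real (B₅ k) ≤ E := fun k => by
      have h := measureReal_labelSum_ge_le hn hX hY hε hlab (A := fun z i => -A k z i)
        (measurable_pi_iff.2 fun i => ((measurable_pi_apply i).comp (hA k)).neg)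
        (fun z i => by rw [abs_neg]; exact hA1 k z i) hT0
      simpa only [neg_mul, Finset.sum_neg_distrib] using h
    have h₄₅ : P.real (⋃ k ∈ Finset.range (n + 1), (B₄ k ∪ B₅ k)) ≤ (n + 1) * (E + E) := by
      refine (measureReal_biUnion_finset_le _ _).trans ?_
      refine (Finset.sum_le_sum fun k _ =>
        (measureReal_union_le (B₄ k) (B₅ k)).trans (add_le_add (h₄ k) (h₅ k))).trans_eq ?_
      rw [Finset.sum_const, Finset.card_range, nsmul_eq_mul]
      push_cast
      rfl
    have hu₁ := measureReal_union_le (μ := P) B₁ B₂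
    have hu₂ := measureReal_union_le (μ := P) (B₁ ∪ B₂) B₃
    have hu₃ := measureReal_union_le (μ := P) ((B₁ ∪ B₂) ∪ B₃)
      (⋃ k ∈ Finset.range (n + 1), (B₄ k ∪ B₅ k))
    calc P.real B ≤ E + E + E + (n + 1) * (E + E) := by linarith
      _ = (2 * n + 5) * E := by ring
  -- the success event need not be known to be measurable: it covers the complement of `B`
  set S : Set Ω := {ω | |isotonicEstimator τ (fun i => f (softLabel D (X i ω)) + ε i ω)
    (fun i => Y i ω) - bayesError D|
      ≤ (2 / c + 16) * (σ + 1 / (n : ℝ) ^ (1 / 3 : ℝ) + Real.sqrt (Real.log (1 / δ) / n))}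
  have hcover : ∀ ω, ω ∉ B → ω ∈ S := by
    intro ω hω
    have h₁ : ∑ i, (W i ω - ∫ ω, W i ω ∂P) < n * t :=
      not_le.1 fun h => hω (Or.inl (Or.inl (Or.inl h)))
    have h₂ : -(n * t) < ∑ i, (W i ω - ∫ ω, W i ω ∂P) :=
      not_le.1 fun h => hω (Or.inl (Or.inl (Or.inr h)))
    have h₃ : ∑ i, (Z i ω - ∫ ω, Z i ω ∂P) < n * t :=
      not_le.1 fun h => hω (Or.inl (Or.inr h))
    have hN : ∀ k ≤ n, |N k ω| ≤ n * t := fun k hk => by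
      have hmem : k ∈ Finset.range (n + 1) := Finset.mem_range.2 (by omega)
      have h₄ : N k ω < n * t :=
        not_le.1 fun h => hω (Or.inr (Set.mem_biUnion hmem (Or.inl h)))
      have h₅ : -N k ω < n * t :=
        not_le.1 fun h => hω (Or.inr (Set.mem_biUnion hmem (Or.inr h)))
      exact abs_le.2 ⟨by linarith, h₄.le⟩
    let π := τ.perm (s (φ ω))
    have hdet := abs_sum_min_isotonicFit_sub_le hc hf (p := fun j => softLabel D (X (π j) ω))
      (e := fun j => ε (π j) ω) (fun j => softLabel_mem_Icc D _) (τ.sorted (s (φ ω)))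
      ((fun i => Y i ω) ∘ π) (T := n * t) (fun k hk => by
        refine le_trans (le_of_eq ?_) (hN k hk)
        congr 1
        refine Eq.trans ?_ (Equiv.sum_comp π fun i => A k (φ ω) i *
          (labelVal (Y i ω) - softLabel D (X i ω)))
        refine Finset.sum_congr rfl fun j _ => ?_
        simp only [A, π, Equiv.symm_apply_apply, Function.comp_apply])
    have hsumW : ∑ j, min (softLabel D (X (π j) ω)) (1 - softLabel D (X (π j) ω))
        = ∑ i, W i ω := Equiv.sum_comp π fun i => W i ω
    have hsumZ : ∑ j, min (|ε (π j) ω| / c) 1 = ∑ i, Z i ω := Equiv.sum_comp π fun i => Z i ω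
    rw [hsumW, hsumZ] at hdet
    have hest : isotonicEstimator τ (fun i => f (softLabel D (X i ω)) + ε i ω) (fun i => Y i ω)
        = (1 / (n : ℝ)) * ∑ j, min (isotonicFit ((fun i => Y i ω) ∘ π) j)
            (1 - isotonicFit ((fun i => Y i ω) ∘ π) j) := rfl
    simp only [S, Set.mem_ofPred_eq]
    rw [hest]
    generalize ∑ j, min (isotonicFit ((fun i => Y i ω) ∘ π) j)
      (1 - isotonicFit ((fun i => Y i ω) ∘ π) j) = U at hdet
    simp only [hW, Finset.sum_sub_distrib, Finset.sum_const, Finset.card_univ, Fintype.card_fin,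
      nsmul_eq_mul] at h₁ h₂
    have hZsum : ∑ i, ∫ ω, Z i ω ∂P ≤ n * (σ / c) :=
      (Finset.sum_le_sum fun i _ => hZi i).trans_eq (by simp)
    rw [Finset.sum_sub_distrib] at h₃
    obtain ⟨hd1, hd2⟩ := abs_le.1 hdet
    have hmain : |U - n * bayesError D| ≤ n * (2 * (σ / c) + 4 * t) :=
      abs_le.2 ⟨by linarith, by linarith⟩
    have hU : 1 / (n : ℝ) * U - bayesError D = (U - n * bayesError D) / n := by field_simp
    rw [hU, abs_div, abs_of_pos hn0]
    refine (div_le_of_le_mul₀ hn0.le (by positivity) (hmain.trans_eq (mul_comm _ _))).trans ?_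
    have hr : 0 ≤ Real.sqrt (Real.log (1 / δ) / n) := Real.sqrt_nonneg _
    have hq : 0 ≤ 1 / (n : ℝ) ^ (1 / 3 : ℝ) := by positivity
    generalize Real.sqrt (Real.log (1 / δ) / n) = r at *
    generalize 1 / (n : ℝ) ^ (1 / 3 : ℝ) = q at *
    have hc2 : 0 ≤ 2 / c * (q + r) := by positivity
    have hσc : 2 / c * σ = 2 * (σ / c) := by ring
    rw [ht]
    linarith
  have huniv : (Set.univ : Set Ω) ⊆ S ∪ B := fun ω _ =>
    (em (ω ∈ B)).elim Or.inr fun h => Or.inl (hcover ω h)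
  have h1 : (1 : ℝ) ≤ P.real S + P.real B :=
    calc (1 : ℝ) = P.real Set.univ := probReal_univ.symm
      _ ≤ P.real (S ∪ B) := measureReal_mono huniv
      _ ≤ _ := measureReal_union_le S B
  linarith
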